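/- Let $d\ge 1$ and let $F$ be the reproducing kernel Hilbert space of functions $f:[0,1]^d\to\mathbb{R}$ with the (positive semidefinite) kernel $$K(\boldsymbol{x},\boldsymbol{y})=\prod_{j=1}^d\Bigl(\frac43+\frac12\bigl(x_j^2+y_j^2-x_j-y_j-|x_j-y_j|\bigr)\Bigr)$$ (the unanchored space). For every infinite sequence of points $(\boldsymbol{x}_i)_{i\ge 0}$ in $[0,1]^d$ there exists a function $f\in F$ such that, writing $$e_n(f)=\Bigl|\int_{[0,1]^d}f(\boldsymbol{y})\,\mathrm{d}\boldsymbol{y}-\frac1n\sum_{i=0}^{n-1}f(\boldsymbol{x}_i)\Bigr| ,$$ all of the following hold: 1. $f$ is integrable and of bounded variation in the sense of Hardy and Krause on $[0,1]^d$, i.e. for every nonempty set $u$ of coordinates, the function of the coordinates in $u$ obtained from $f$ by setting all other coordinates equal to $1$ has finite Vitali variation; 2. $$\limsup_{n\to\infty}\frac{e_n(f)}{(n\log\log n)^{-1}(\log n)^{(d-1)/2}}=+\infty ;$$ 3. for every real $r<(d-1)/2$ and every $c>0$, the inequality $e_n(f)>c\,(\log n)^r/n$ holds for infinitely many $n$.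 -/

import Mathlib

open MeasureTheory Filter
open scoped ENNReal

noncomputable section

/-! ### The unanchored reproducing kernel Hilbert space on `[0,1]^d` -/

/-- The one-dimensional factor `4/3 + (s² + t² - s - t - |s - t|)/2` of the unanchored kernel. -/
def unanchoredKernel1 (s t : unitInterval) : ℝ :=
  4 / 3 + 1 / 2 * ((s : ℝ) ^ 2 + (t : ℝ) ^ 2 - s - t - |(s : ℝ) - t|)

/-- The kernel `K(x, y) = ∏ⱼ (4/3 + (xⱼ² + yⱼ² - xⱼ - yⱼ - |xⱼ - yⱼ|)/2)` of the unanchored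
space on `[0,1]^d`. -/
def unanchoredKernel (d : ℕ) (x y : Fin d → unitInterval) : ℝ :=
  ∏ j, unanchoredKernel1 (x j) (y j)

/-- The kernel in the format of Mathlib's theory of (vector-valued) reproducing kernel Hilbert
spaces: the scalar `K(x, y)` is regarded as the operator `v ↦ K(x, y) v` on `ℝ`. -/
def unanchoredKernelOp (d : ℕ) :
    Matrix (Fin d → unitInterval) (Fin d → unitInterval) (ℝ →L[ℝ] ℝ) :=
  Matrix.of fun x y => unanchoredKernel d x y • ContinuousLinearMap.id ℝ ℝ

/-! The kernel is positive semidefinite. -/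

lemma integral_mul_indicator_Ioi {g : ℝ → ℝ} {s : ℝ} (h0 : 0 ≤ s) (h1 : s ≤ 1) :
    ∫ u in (0 : ℝ)..1, (Set.Ioi s).indicator g u = ∫ u in s..1, g u := by
  rw [intervalIntegral.integral_of_le zero_le_one, intervalIntegral.integral_of_le h1,
    setIntegral_indicator measurableSet_Ioi, Set.Ioc_inter_Ioi, max_eq_right h0]

/-- The feature function `u ↦ u - 1{u > s}`, which is the derivative of the kernel. -/
def unanchoredFeature (s u : ℝ) : ℝ := u - (Set.Ioi s).indicator (fun _ => (1 : ℝ)) u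

lemma unanchoredFeature_intervalIntegrable_mul (s t : ℝ) :
    IntervalIntegrable (fun u => unanchoredFeature s u * unanchoredFeature t u) volume 0 1 := by
  have hm : ∀ s, Measurable (unanchoredFeature s) := fun s =>
    measurable_id.sub (measurable_const.indicator measurableSet_Ioi)
  have hb : ∀ s, ∀ u ∈ Set.uIoc (0 : ℝ) 1, |unanchoredFeature s u| ≤ 1 := by
    intro s u hu
    rw [Set.uIoc_of_le zero_le_one] at hu
    unfold unanchoredFeature
    by_cases h : u ∈ Set.Ioi s
    · rw [Set.indicator_of_mem h, abs_le]; constructor <;> linarith [hu.1, hu.2]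
    · rw [Set.indicator_of_notMem h, abs_le]; constructor <;> linarith [hu.1, hu.2]
  have hc : IntervalIntegrable (fun _ : ℝ => (1 : ℝ)) volume 0 1 := intervalIntegrable_const
  refine hc.mono_fun ((hm s).mul (hm t)).aestronglyMeasurable ?_
  refine (ae_restrict_iff' measurableSet_uIoc).2 (Eventually.of_forall fun u hu => ?_)
  simp only [norm_mul, Real.norm_eq_abs, abs_one]
  exact mul_le_one₀ (hb s u hu) (abs_nonneg _) (hb t u hu)

lemma unanchoredKernel1_eq (s t : unitInterval) :
    unanchoredKernel1 s t
      = 1 + ∫ u in (0 : ℝ)..1, unanchoredFeature s u * unanchoredFeature t u := by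
  have e : ∀ u : ℝ, unanchoredFeature s u * unanchoredFeature t u
      = u ^ 2 - (Set.Ioi (s : ℝ)).indicator (fun u => u) u
        - (Set.Ioi (t : ℝ)).indicator (fun u => u) u
        + (Set.Ioi (max (s : ℝ) t)).indicator (fun _ => (1 : ℝ)) u := by
    intro u
    simp only [unanchoredFeature, Set.indicator_apply, Set.mem_Ioi, max_lt_iff]
    by_cases h1 : (s : ℝ) < u <;> by_cases h2 : (t : ℝ) < u <;> simp [h1, h2] <;> ring
  have hi : ∀ (a : ℝ) (g : ℝ → ℝ), Continuous g →
      IntervalIntegrable ((Set.Ioi a).indicator g) volume 0 1 := by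
    intro a g hg
    have := hg.intervalIntegrable (μ := volume) 0 1
    rw [intervalIntegrable_iff] at this ⊢
    exact this.indicator measurableSet_Ioi
  have hp : IntervalIntegrable (fun u : ℝ => u ^ 2) volume 0 1 :=
    (continuous_id.pow 2).intervalIntegrable 0 1
  have i1 := hi s (fun u => u) continuous_id
  have i2 := hi t (fun u => u) continuous_id
  have i3 := hi (max (s : ℝ) t) (fun _ => 1) continuous_const
  simp_rw [e]
  rw [intervalIntegral.integral_add ((hp.sub i1).sub i2) i3,
    intervalIntegral.integral_sub (hp.sub i1) i2, intervalIntegral.integral_sub hp i1,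
    integral_mul_indicator_Ioi s.2.1 s.2.2, integral_mul_indicator_Ioi t.2.1 t.2.2,
    integral_mul_indicator_Ioi (le_max_of_le_left s.2.1) (max_le s.2.2 t.2.2)]
  simp only [integral_pow, integral_id, intervalIntegral.integral_const, smul_eq_mul,
    unanchoredKernel1]
  rcases le_total (s : ℝ) t with h | h
  · rw [max_eq_right h, abs_of_nonpos (by linarith)]; norm_num; ring
  · rw [max_eq_left h, abs_of_nonneg (by linarith)]; norm_num; ring

lemma unanchoredKernel1_posSemidef :
    (Matrix.of unanchoredKernel1 : Matrix unitInterval unitInterval ℝ).PosSemidef := by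
  refine ⟨?_, fun c => ?_⟩
  · ext s t
    simp only [Matrix.conjTranspose_apply, Matrix.of_apply, star_trivial, unanchoredKernel1,
      abs_sub_comm (t : ℝ) s]
    ring
  · have hI : ∀ s t : unitInterval, IntervalIntegrable
        (fun u => c s * (unanchoredFeature s u * unanchoredFeature t u) * c t) volume 0 1 :=
      fun s t => ((unanchoredFeature_intervalIntegrable_mul s t).const_mul _).mul_const _
    have h : (c.sum fun s a => c.sum fun t b => star a * Matrix.of unanchoredKernel1 s t * b)
        = (∑ s ∈ c.support, c s) ^ 2
          + ∫ u in (0 : ℝ)..1, (∑ s ∈ c.support, c s * unanchoredFeature s u) ^ 2 := by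
      have e2 : ∀ u : ℝ, (∑ s ∈ c.support, c s * unanchoredFeature s u) ^ 2
          = ∑ s ∈ c.support, ∑ t ∈ c.support,
              c s * (unanchoredFeature s u * unanchoredFeature t u) * c t := by
        intro u
        rw [sq, Finset.sum_mul_sum]
        refine Finset.sum_congr rfl fun s _ => Finset.sum_congr rfl fun t _ => ?_
        ring
      simp_rw [e2]
      have e3 : ∀ s ∈ c.support, IntervalIntegrable (fun u => ∑ t ∈ c.support,
          c s * (unanchoredFeature s u * unanchoredFeature t u) * c t) volume 0 1 := by
        intro s _
        have := IntervalIntegrable.sum c.support fun t _ => hI s t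
        simpa only [← Finset.sum_fn] using this
      rw [intervalIntegral.integral_finsetSum e3]
      have e4 : ∀ s : unitInterval, ∫ u in (0 : ℝ)..1, ∑ t ∈ c.support,
          c s * (unanchoredFeature s u * unanchoredFeature t u) * c t = ∑ t ∈ c.support,
          ∫ u in (0 : ℝ)..1, c s * (unanchoredFeature s u * unanchoredFeature t u) * c t :=
        fun s => intervalIntegral.integral_finsetSum fun t _ => hI s t
      simp_rw [e4]
      rw [sq, Finset.sum_mul_sum, ← Finset.sum_add_distrib]
      simp only [Finsupp.sum]
      refine Finset.sum_congr rfl fun s _ => ?_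
      rw [← Finset.sum_add_distrib]
      refine Finset.sum_congr rfl fun t _ => ?_
      rw [intervalIntegral.integral_mul_const, intervalIntegral.integral_const_mul,
        Matrix.of_apply, unanchoredKernel1_eq, star_trivial]
      ring
    rw [h]
    exact add_nonneg (sq_nonneg _)
      (intervalIntegral.integral_nonneg zero_le_one fun u _ => sq_nonneg _)

lemma unanchoredKernel_posSemidef (d : ℕ) : (Matrix.of (unanchoredKernel d) :
    Matrix (Fin d → unitInterval) (Fin d → unitInterval) ℝ).PosSemidef := by
  classical
  have h : ∀ S : Finset (Fin d), (Matrix.of (fun x y => ∏ j ∈ S, unanchoredKernel1 (x j) (y j)) :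
      Matrix (Fin d → unitInterval) (Fin d → unitInterval) ℝ).PosSemidef := by
    intro S
    induction S using Finset.induction_on with
    | empty =>
      refine ⟨by ext; simp, fun c => ?_⟩
      have : (c.sum fun x a => c.sum fun y b => star a * (Matrix.of (fun (x y :
          Fin d → unitInterval) => ∏ j ∈ (∅ : Finset (Fin d)), unanchoredKernel1 (x j) (y j)))
          x y * b) = (∑ x ∈ c.support, c x) ^ 2 := by
        simp [Finsupp.sum, sq, Finset.sum_mul_sum]
      rw [this]
      exact sq_nonneg _
    | insert a S ha ih =>
      have h1 := unanchoredKernel1_posSemidef.submatrix (fun x : Fin d → unitInterval => x a)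
      have e : (Matrix.of (fun x y => ∏ j ∈ insert a S, unanchoredKernel1 (x j) (y j)) :
          Matrix (Fin d → unitInterval) (Fin d → unitInterval) ℝ)
          = ((Matrix.of unanchoredKernel1).submatrix (fun x => x a) fun x => x a).hadamard
            (Matrix.of fun x y => ∏ j ∈ S, unanchoredKernel1 (x j) (y j)) := by
        ext x y
        simp [Finset.prod_insert ha]
      rw [e]
      exact h1.hadamard ih
  exact h Finset.univ

instance unanchoredKernelOp_posSemidef (d : ℕ) : Fact (unanchoredKernelOp d).PosSemidef := by
  have key : (unanchoredKernelOp d).PosSemidef ↔ _ := RKHS.posSemidef_tfae.out 0 2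
  refine ⟨key.2 ⟨?_, fun c => ?_⟩⟩
  · ext x y
    have := congrFun (congrFun (unanchoredKernel_posSemidef d).1 x) y
    simp only [Matrix.conjTranspose_apply, Matrix.of_apply, star_trivial] at this
    have h1 : star (ContinuousLinearMap.id ℝ ℝ) = ContinuousLinearMap.id ℝ ℝ :=
      star_one (ℝ →L[ℝ] ℝ)
    simp [unanchoredKernelOp, this, h1]
  · have := (unanchoredKernel_posSemidef d).2 c
    refine this.trans_eq ?_
    rw [Finsupp.sum_comm]
    simp only [unanchoredKernelOp, RCLike.re_to_real, star_trivial, Matrix.of_apply]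
    refine Finset.sum_congr rfl fun x _ => Finset.sum_congr rfl fun y _ => ?_
    simp only [smul_apply, ContinuousLinearMap.id_apply, smul_eq_mul, RCLike.inner_apply,
      conj_trivial]
    ring

/-- The unanchored space: the reproducing kernel Hilbert space of functions `[0,1]^d → ℝ` whose
kernel is `unanchoredKernel d`. Its elements coerce to functions. -/
abbrev UnanchoredSpace (d : ℕ) : Type := RKHS.OfKernel (unanchoredKernelOp d)

/-! ### Bounded variation in the sense of Hardy and Krause -/

/-- A ladder on `[0,1]`: a partition `0 = t₀ < t₁ < ⋯ < t_N = 1`. -/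
structure Ladder where
  /-- the number of subintervals -/
  size : ℕ
  /-- the partition points -/
  pt : Fin (size + 1) → unitInterval
  strictMono_pt : StrictMono pt
  pt_zero : pt 0 = 0
  pt_last : pt (Fin.last size) = 1

/-- The `d`-fold alternating sum `Δ(f; a, b) = ∑_v (-1)^|v| f(a_v, b_{-v})` of `f` over the
vertices of the box `[a, b]`. -/
def boxDiff {ι : Type} [Fintype ι] [DecidableEq ι] (f : (ι → unitInterval) → ℝ)
    (a b : ι → unitInterval) : ℝ :=
  ∑ v : Finset ι, (-1) ^ v.card * f (v.piecewise a b)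

/-- The variation in the sense of Vitali: the supremum, over all grids formed from one ladder per
coordinate, of the sum of `|Δ|` over the cells of the grid. -/
def vitaliVariation {ι : Type} [Fintype ι] [DecidableEq ι] (f : (ι → unitInterval) → ℝ) : ℝ≥0∞ :=
  ⨆ L : ι → Ladder, ∑ k : (j : ι) → Fin (L j).size,
    ENNReal.ofReal |boxDiff f (fun j => (L j).pt (k j).castSucc) (fun j => (L j).pt (k j).succ)|

/-- The restriction of `f` to the face of the cube in which the coordinates in `u` are free and all
other coordinates equal `1`. -/
def faceRestrict {d : ℕ} (f : (Fin d → unitInterval) → ℝ) (u : Finset (Fin d))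
    (z : u → unitInterval) : ℝ :=
  f fun j => if h : j ∈ u then z ⟨j, h⟩ else 1

/-- The variation in the sense of Hardy and Krause: the sum, over the nonempty sets `u` of
coordinates, of the Vitali variations of the restrictions of `f` to the faces. -/
def hardyKrauseVariation {d : ℕ} (f : (Fin d → unitInterval) → ℝ) : ℝ≥0∞ :=
  ∑ u : Finset (Fin d) with u.Nonempty, vitaliVariation (faceRestrict f u)

/-- `f ∈ BVHK[0,1]^d`. -/
def IsBVHK {d : ℕ} (f : (Fin d → unitInterval) → ℝ) : Prop := hardyKrauseVariation f < ⊤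

/-! ### The quasi-Monte Carlo error -/

/-- The absolute error `|∫ f - (1/n) ∑_{i<n} f(xᵢ)|` of the equal-weight rule which uses the first
`n` points of the sequence `x`. -/
def qmcError {d : ℕ} (x : ℕ → Fin d → unitInterval) (f : (Fin d → unitInterval) → ℝ) (n : ℕ) : ℝ :=
  |(∫ y, f y) - 1 / (n : ℝ) * ∑ i ∈ Finset.range n, f (x i)|

end

/-!
The error of the rule with nodes `x 0, …, x (n - 1)` is the inner product with a vector `errVec x n`
of the unanchored space. Roth's method gives `n ‖errVec x n‖ ≥ c (log n) ^ ((d - 1) / 2)` for every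
choice of the nodes (`exists_log_le_norm_errVec`). Dividing `errVec x n` by
`(n log log n)⁻¹ (log n) ^ ((d - 1) / 2)` thus leaves a sequence whose norms tend to infinity, and the
uniform boundedness principle yields one `f` whose normalized errors are unbounded. The statement on
the exponents `r < (d - 1) / 2` follows, as `log log n` is negligible against positive powers of
`log n`.

The lower bound is obtained by testing `errVec x n` against a sum of tensor products of hat
functions. Let `2n ≤ 2 ^ m ≤ 4n`. For each shape `r` with `∑ j, r j = m`, at least half of the `2 ^ m`
dyadic boxes of shape `r` have no node in their interior (`two_pow_le_card_emptyBoxes_add`). The sum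
of the hat functions on these boxes vanishes at all nodes, and has integral of order `2 ^ (-m)`, so
the test function `testVec x n S` has error of order `R / n`, where `R` is the number of shapes. The
derivatives of the hat functions are Haar functions, hence orthogonal; the additional terms of the
norm of the unanchored space, which come from integrals, decay geometrically in the levels. So the
square of the norm of the test function is of order at most `R` (`norm_testVec_sq_le`), and as
`R ≥ c (log n) ^ (d - 1)` (`exists_shapes`), the bound follows from the Cauchy–Schwarz inequality.

All inner products are computed from the kernel alone. The one-dimensional hat function is represented
by a combination of three point evaluations and the integral, and `optVec` provides the representers
of the functionals that evaluate in some coordinates and integrate over the others.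

Every element of the unanchored space is continuous and has bounded variation: the increments of the
kernel over the cells of a grid are orthogonal, with squared norms proportional to the volumes of the
cells (`vitaliVariation_inner_le`).
-/

/-! ### Kernel vectors and partially integrated kernel vectors -/

/-- The representer of the evaluation at `x`. -/
noncomputable def kerVec {d : ℕ} (x : Fin d → unitInterval) : UnanchoredSpace d :=
  RKHS.kerFun (UnanchoredSpace d) x (1 : ℝ)

lemma inner_kerVec {d : ℕ} (x : Fin d → unitInterval) (f : UnanchoredSpace d) :
    inner ℝ (kerVec x) f = f x := by
  simp [kerVec]

lemma kerVec_apply {d : ℕ} (x y : Fin d → unitInterval) :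
    kerVec y x = unanchoredKernel d x y := by
  rw [kerVec, RKHS.kerFun_apply, RKHS.OfKernel.kernel_ofKernel]
  simp [unanchoredKernelOp]

lemma inner_kerVec_kerVec {d : ℕ} (x y : Fin d → unitInterval) :
    inner ℝ (kerVec x) (kerVec y) = unanchoredKernel d x y := by
  rw [inner_kerVec, kerVec_apply]

lemma unanchoredKernel1_comm (s t : unitInterval) :
    unanchoredKernel1 s t = unanchoredKernel1 t s := by
  simp only [unanchoredKernel1, abs_sub_comm (t : ℝ) s]
  ring

lemma continuous_unanchoredKernel (d : ℕ) :
    Continuous fun p : (Fin d → unitInterval) × (Fin d → unitInterval) =>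
      unanchoredKernel d p.1 p.2 := by
  unfold unanchoredKernel unanchoredKernel1
  fun_prop

/-- A map into an inner product space is continuous if its Gram kernel is. -/
lemma continuous_of_continuous_inner {X E : Type*} [TopologicalSpace X] [NormedAddCommGroup E]
    [InnerProductSpace ℝ E] {V : X → E}
    (h : Continuous fun p : X × X => (inner ℝ (V p.1) (V p.2) : ℝ)) : Continuous V := by
  rw [continuous_iff_continuousAt]
  intro x
  have h1 : Continuous fun y => (inner ℝ (V y) (V y) : ℝ) :=
    h.comp (continuous_id.prodMk continuous_id)
  have h2 : Continuous fun y => (inner ℝ (V y) (V x) : ℝ) :=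
    h.comp (continuous_id.prodMk continuous_const)
  have e : ∀ y, ‖V y - V x‖ ^ 2
      = inner ℝ (V y) (V y) - 2 * inner ℝ (V y) (V x) + inner ℝ (V x) (V x) := by
    intro y
    rw [@norm_sub_sq_real, ← real_inner_self_eq_norm_sq, ← real_inner_self_eq_norm_sq]
  have h3 : Tendsto (fun y => ‖V y - V x‖ ^ 2) (nhds x) (nhds (‖V x - V x‖ ^ 2)) := by
    simp_rw [e]
    exact ((h1.sub (h2.const_mul 2)).add continuous_const).tendsto x
  refine tendsto_iff_norm_sub_tendsto_zero.2 ?_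
  simpa [Real.sqrt_sq (norm_nonneg _)] using h3.sqrt

lemma continuous_kerVec (d : ℕ) : Continuous (kerVec (d := d)) := by
  refine continuous_of_continuous_inner ?_
  simp_rw [inner_kerVec_kerVec]
  exact continuous_unanchoredKernel d

lemma continuous_unanchoredSpace {d : ℕ} (f : UnanchoredSpace d) :
    Continuous (f : (Fin d → unitInterval) → ℝ) := by
  have : (f : (Fin d → unitInterval) → ℝ) = fun x => inner ℝ (kerVec x) f := by
    funext x; rw [inner_kerVec]
  rw [this]
  exact (continuous_kerVec d).inner continuous_const

lemma integrable_unanchoredSpace {d : ℕ} (f : UnanchoredSpace d) :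
    Integrable (f : (Fin d → unitInterval) → ℝ) volume :=
  (continuous_unanchoredSpace f).integrable_of_hasCompactSupport (HasCompactSupport.of_compactSpace _)

lemma integral_unanchoredKernel1 (s : unitInterval) : ∫ t, unanchoredKernel1 s t = 1 := by
  have h0 := s.2.1
  have h1 := s.2.2
  have e1 : ∫ t : unitInterval, unanchoredKernel1 s t
      = ∫ t in Set.Icc (0 : ℝ) 1, (4 / 3 + 1 / 2 * ((s : ℝ) ^ 2 + t ^ 2 - s - t - |(s : ℝ) - t|)) :=
    integral_subtype (s := Set.Icc (0 : ℝ) 1) measurableSet_Icc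
      (fun t : ℝ => 4 / 3 + 1 / 2 * ((s : ℝ) ^ 2 + t ^ 2 - s - t - |(s : ℝ) - t|))
  have hc : Continuous fun t : ℝ =>
      4 / 3 + 1 / 2 * ((s : ℝ) ^ 2 + t ^ 2 - s - t - |(s : ℝ) - t|) := by fun_prop
  rw [e1, integral_Icc_eq_integral_Ioc, ← intervalIntegral.integral_of_le zero_le_one,
    ← intervalIntegral.integral_add_adjacent_intervals (hc.intervalIntegrable 0 s)
      (hc.intervalIntegrable s 1)]
  have a1 : ∫ t in (0 : ℝ)..s, (4 / 3 + 1 / 2 * ((s : ℝ) ^ 2 + t ^ 2 - s - t - |(s : ℝ) - t|))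
      = ∫ t in (0 : ℝ)..s, ((4 / 3 + 1 / 2 * (s : ℝ) ^ 2 - s) + 1 / 2 * t ^ 2) := by
    refine intervalIntegral.integral_congr fun t ht => ?_
    rw [Set.uIcc_of_le h0] at ht
    rw [abs_of_nonneg (by linarith [ht.2])]
    ring
  have a2 : ∫ t in (s : ℝ)..1, (4 / 3 + 1 / 2 * ((s : ℝ) ^ 2 + t ^ 2 - s - t - |(s : ℝ) - t|))
      = ∫ t in (s : ℝ)..1, ((4 / 3 + 1 / 2 * (s : ℝ) ^ 2) + (1 / 2 * t ^ 2 - t)) := by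
    refine intervalIntegral.integral_congr fun t ht => ?_
    rw [Set.uIcc_of_le h1] at ht
    rw [abs_of_nonpos (by linarith [ht.1])]
    ring
  have i1 : ∀ a b : ℝ, IntervalIntegrable (fun t : ℝ => 1 / 2 * t ^ 2) volume a b := fun a b =>
    Continuous.intervalIntegrable (by fun_prop) a b
  have i2 : ∀ a b : ℝ, IntervalIntegrable (fun t : ℝ => t) volume a b := fun a b =>
    Continuous.intervalIntegrable (by fun_prop) a b
  rw [a1, a2, intervalIntegral.integral_add intervalIntegrable_const (i1 _ _),
    intervalIntegral.integral_add intervalIntegrable_const ((i1 _ _).sub (i2 _ _)),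
    intervalIntegral.integral_sub (i1 _ _) (i2 _ _)]
  simp only [intervalIntegral.integral_const, intervalIntegral.integral_const_mul, integral_pow,
    integral_id, smul_eq_mul]
  norm_num
  ring

/-- The one-dimensional kernel with an additional index `none`, which stands for integration of the
argument over `[0,1]`; both `∫ K(s, t) dt` and `∫∫ K(s, t) ds dt` are equal to `1`. -/
noncomputable def kerOpt : Option unitInterval → Option unitInterval → ℝ
  | some s, some t => unanchoredKernel1 s t
  | _, _ => 1

lemma kerOpt_comm (p q : Option unitInterval) : kerOpt p q = kerOpt q p := by
  cases p <;> cases q <;> simp [kerOpt, unanchoredKernel1_comm]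

lemma integral_kerOpt_some_getD (s : unitInterval) (q : Option unitInterval) :
    ∫ t, unanchoredKernel1 s (q.getD t) = kerOpt (some s) q := by
  cases q with
  | none => exact integral_unanchoredKernel1 s
  | some t => simp [kerOpt]

lemma integral_kerOpt_getD (p q : Option unitInterval) :
    ∫ t, kerOpt (some (p.getD t)) q = kerOpt p q := by
  cases p with
  | some s => simp
  | none =>
    cases q with
    | none => simp [kerOpt]
    | some s =>
      simp only [kerOpt, Option.getD_none]
      simp_rw [unanchoredKernel1_comm _ s]
      exact integral_unanchoredKernel1 s

/-- The representer of the functional which evaluates at `p j` in each coordinate `j` with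
`p j ≠ none`, and integrates over the other coordinates. -/
noncomputable def optVec {d : ℕ} (p : Fin d → Option unitInterval) : UnanchoredSpace d :=
  ∫ y : Fin d → unitInterval, kerVec fun j => (p j).getD (y j)

lemma integrable_kerVec_getD {d : ℕ} (p : Fin d → Option unitInterval) :
    Integrable fun y : Fin d → unitInterval => kerVec fun j => (p j).getD (y j) := by
  have h : Continuous fun y : Fin d → unitInterval => kerVec fun j => (p j).getD (y j) := by
    refine (continuous_kerVec d).comp (continuous_pi fun j => ?_)
    cases p j with
    | none => exact continuous_apply j
    | some s => exact continuous_const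
  exact h.integrable_of_hasCompactSupport (HasCompactSupport.of_compactSpace _)

lemma inner_optVec {d : ℕ} (p : Fin d → Option unitInterval) (f : UnanchoredSpace d) :
    inner ℝ (optVec p) f = ∫ y : Fin d → unitInterval, f fun j => (p j).getD (y j) := by
  rw [real_inner_comm, optVec, ← integral_inner (integrable_kerVec_getD p)]
  simp_rw [real_inner_comm _ f, inner_kerVec]

lemma inner_optVec_none {d : ℕ} (f : UnanchoredSpace d) :
    inner ℝ (optVec fun _ => none) f = ∫ y, f y := by
  rw [inner_optVec]
  rfl

lemma optVec_some {d : ℕ} (x : Fin d → unitInterval) : optVec (fun j => some (x j)) = kerVec x := by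
  simp [optVec]

lemma optVec_apply {d : ℕ} (q : Fin d → Option unitInterval) (x : Fin d → unitInterval) :
    optVec q x = ∏ j, kerOpt (some (x j)) (q j) := by
  rw [← inner_kerVec, real_inner_comm, inner_optVec]
  simp_rw [kerVec_apply, unanchoredKernel]
  rw [integral_fintype_prod_volume_eq_prod
    (fun j t => unanchoredKernel1 ((q j).getD t) (x j))]
  refine Finset.prod_congr rfl fun j _ => ?_
  simp_rw [unanchoredKernel1_comm _ (x j)]
  exact integral_kerOpt_some_getD _ _

lemma inner_optVec_optVec {d : ℕ} (p q : Fin d → Option unitInterval) :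
    inner ℝ (optVec p) (optVec q) = ∏ j, kerOpt (p j) (q j) := by
  rw [inner_optVec]
  simp_rw [optVec_apply]
  rw [integral_fintype_prod_volume_eq_prod (fun j t => kerOpt (some ((p j).getD t)) (q j))]
  exact Finset.prod_congr rfl fun j _ => integral_kerOpt_getD _ _

/-! ### Bounded variation of the elements of the unanchored space -/

section BoundedVariation

variable {ι : Type} [Fintype ι] [DecidableEq ι]

lemma boxDiff_const_mul (c : ℝ) (f : (ι → unitInterval) → ℝ) (a b : ι → unitInterval) :
    boxDiff (fun z => c * f z) a b = c * boxDiff f a b := by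
  simp only [boxDiff, Finset.mul_sum]
  exact Finset.sum_congr rfl fun v _ => by ring

lemma boxDiff_prod (g : ι → unitInterval → ℝ) (a b : ι → unitInterval) :
    boxDiff (fun z => ∏ j, g j (z j)) a b = ∏ j, (g j (b j) - g j (a j)) := by
  rw [Finset.prod_sub, Finset.powerset_univ, boxDiff]
  refine Finset.sum_congr rfl fun v _ => ?_
  rw [mul_assoc, ← Finset.prod_sdiff (Finset.subset_univ v)]
  congr 2
  · refine Finset.prod_congr rfl fun j hj => ?_
    rw [Finset.piecewise_eq_of_notMem _ _ _ (Finset.mem_sdiff.1 hj).2]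
  · refine Finset.prod_congr rfl fun j hj => ?_
    rw [Finset.piecewise_eq_of_mem _ _ _ hj]

variable {H : Type*} [NormedAddCommGroup H] [InnerProductSpace ℝ H]

/-- The alternating sum of a vector-valued map over the vertices of the box `[a, b]`. -/
noncomputable def boxDiffVec (P : (ι → unitInterval) → H) (a b : ι → unitInterval) : H :=
  ∑ v : Finset ι, ((-1 : ℝ) ^ v.card) • P (v.piecewise a b)

lemma inner_boxDiffVec (P : (ι → unitInterval) → H) (a b : ι → unitInterval) (f : H) :
    inner ℝ (boxDiffVec P a b) f = boxDiff (fun z => inner ℝ (P z) f) a b := by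
  simp [boxDiffVec, boxDiff, sum_inner, real_inner_smul_left]

lemma inner_boxDiffVec_boxDiffVec {P : (ι → unitInterval) → H} {C : ℝ}
    (hP : ∀ z w, inner ℝ (P z) (P w) = C * ∏ j, unanchoredKernel1 (z j) (w j))
    (a b a' b' : ι → unitInterval) :
    inner ℝ (boxDiffVec P a b) (boxDiffVec P a' b')
      = C * ∏ j, ((unanchoredKernel1 (b j) (b' j) - unanchoredKernel1 (b j) (a' j))
        - (unanchoredKernel1 (a j) (b' j) - unanchoredKernel1 (a j) (a' j))) := by
  rw [inner_boxDiffVec]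
  have h : ∀ z, inner ℝ (P z) (boxDiffVec P a' b')
      = C * ∏ j, (unanchoredKernel1 (z j) (b' j) - unanchoredKernel1 (z j) (a' j)) := by
    intro z
    rw [real_inner_comm, inner_boxDiffVec]
    simp_rw [real_inner_comm (P z), hP]
    rw [boxDiff_const_mul, boxDiff_prod (fun j t => unanchoredKernel1 (z j) t)]
  simp_rw [h]
  rw [boxDiff_const_mul,
    boxDiff_prod (fun j t => unanchoredKernel1 t (b' j) - unanchoredKernel1 t (a' j))]

/-- Increments of the kernel vectors over distinct cells of a ladder are orthogonal, and over a
single cell they have squared norm equal to the length of the cell. -/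
lemma unanchoredKernel1_ladder (L : Ladder) (k l : Fin L.size) :
    (unanchoredKernel1 (L.pt k.succ) (L.pt l.succ) - unanchoredKernel1 (L.pt k.succ) (L.pt l.castSucc))
      - (unanchoredKernel1 (L.pt k.castSucc) (L.pt l.succ)
        - unanchoredKernel1 (L.pt k.castSucc) (L.pt l.castSucc))
      = if k = l then (L.pt k.succ : ℝ) - L.pt k.castSucc else 0 := by
  have hm : ∀ {i j : Fin (L.size + 1)}, i ≤ j → (L.pt i : ℝ) ≤ L.pt j := fun h =>
    Subtype.coe_le_coe.2 (L.strictMono_pt.monotone h)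
  simp only [unanchoredKernel1]
  have hk := hm (Fin.castSucc_lt_succ (i := k)).le
  have hl := hm (Fin.castSucc_lt_succ (i := l)).le
  split_ifs with h
  · subst h
    rw [abs_of_nonneg (sub_nonneg.2 hk), abs_of_nonpos (sub_nonpos.2 hk)]
    simp
    ring
  · rcases lt_or_gt_of_ne h with h | h
    · have h1 := hm (Fin.succ_le_castSucc_iff.2 h)
      rw [abs_of_nonpos (by linarith), abs_of_nonpos (by linarith), abs_of_nonpos (by linarith),
        abs_of_nonpos (by linarith)]
      ring
    · have h1 := hm (Fin.succ_le_castSucc_iff.2 h)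
      rw [abs_of_nonneg (by linarith), abs_of_nonneg (by linarith), abs_of_nonneg (by linarith),
        abs_of_nonneg (by linarith)]
      ring

lemma Ladder.sum_length (L : Ladder) :
    ∑ k : Fin L.size, ((L.pt k.succ : ℝ) - L.pt k.castSucc) = 1 := by
  have h := (Fin.sum_univ_succ fun k => (L.pt k : ℝ)).symm.trans (Fin.sum_univ_castSucc _)
  rw [L.pt_zero, L.pt_last] at h
  rw [Finset.sum_sub_distrib]
  simp only [Set.Icc.coe_zero, Set.Icc.coe_one] at h
  linarith

/-- By the orthogonality of the increments of `P` over the cells of a grid, a signed sum of these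
increments has norm `√C`; the Vitali variation is bounded by the Cauchy–Schwarz inequality. -/
lemma vitaliVariation_inner_le {P : (ι → unitInterval) → H} {C : ℝ}
    (hP : ∀ z w, inner ℝ (P z) (P w) = C * ∏ j, unanchoredKernel1 (z j) (w j)) (f : H) :
    vitaliVariation (fun z => inner ℝ (P z) f) ≤ ENNReal.ofReal (√C * ‖f‖) := by
  refine iSup_le fun L => ?_
  rw [← ENNReal.ofReal_sum_of_nonneg fun _ _ => abs_nonneg _]
  refine ENNReal.ofReal_le_ofReal ?_
  set V : ((j : ι) → Fin (L j).size) → H := fun k =>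
    boxDiffVec P (fun j => (L j).pt (k j).castSucc) (fun j => (L j).pt (k j).succ) with hV
  have hVV : ∀ k l, inner ℝ (V k) (V l) = if k = l then
      C * ∏ j, (((L j).pt (k j).succ : ℝ) - (L j).pt (k j).castSucc) else 0 := by
    intro k l
    rw [hV, inner_boxDiffVec_boxDiffVec hP]
    simp_rw [unanchoredKernel1_ladder]
    split_ifs with h
    · subst h; simp
    · obtain ⟨j, hj⟩ := Function.ne_iff.1 h
      rw [Finset.prod_eq_zero (Finset.mem_univ j) (if_neg hj), mul_zero]
  obtain ⟨ε, hε, hε'⟩ : ∃ ε : ((j : ι) → Fin (L j).size) → ℝ,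
      (∀ k, ε k * ε k ≤ 1) ∧ ∀ k, |inner ℝ (V k) f| = ε k * inner ℝ (V k) f := by
    refine ⟨fun k => if 0 ≤ inner ℝ (V k) f then 1 else -1, fun k => ?_, fun k => ?_⟩
    · simp only; split_ifs <;> norm_num
    · simp only
      split_ifs with h
      · rw [abs_of_nonneg h, one_mul]
      · rw [abs_of_neg (not_le.1 h)]; ring
  -- `C` is nonnegative since `C (4 / 3) ^ |ι|` is the squared norm of `P` at the vertex `(1, …, 1)`
  have hC : 0 ≤ C * ∏ _j : ι, (4 / 3 : ℝ) := by
    have h := real_inner_self_nonneg (x := P fun _ => 1)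
    rw [hP] at h
    simpa [unanchoredKernel1] using h
  have hC0 : 0 ≤ C := nonneg_of_mul_nonneg_left hC (Finset.prod_pos fun _ _ => by norm_num)
  have hnorm : ‖∑ k, ε k • V k‖ ≤ √C := by
    refine Real.le_sqrt_of_sq_le ?_
    rw [← real_inner_self_eq_norm_sq, sum_inner]
    simp_rw [inner_sum, real_inner_smul_left, real_inner_smul_right, hVV]
    have hlen : ∀ k : (j : ι) → Fin (L j).size,
        0 ≤ ∏ j, (((L j).pt (k j).succ : ℝ) - (L j).pt (k j).castSucc) := fun k =>
      Finset.prod_nonneg fun j _ => sub_nonneg.2 (Subtype.coe_le_coe.2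
        ((L j).strictMono_pt Fin.castSucc_lt_succ).le)
    calc _ = ∑ k : (j : ι) → Fin (L j).size, ε k * ε k *
          (C * ∏ j, (((L j).pt (k j).succ : ℝ) - (L j).pt (k j).castSucc)) := by
          refine Finset.sum_congr rfl fun k _ => ?_
          simp [mul_assoc]
      _ ≤ ∑ k : (j : ι) → Fin (L j).size,
          C * ∏ j, (((L j).pt (k j).succ : ℝ) - (L j).pt (k j).castSucc) :=
          Finset.sum_le_sum fun k _ => mul_le_of_le_one_left (mul_nonneg hC0 (hlen k)) (hε k)
      _ = C := by
          rw [← Finset.mul_sum, ← Fintype.piFinset_univ, ← Finset.prod_univ_sum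
            (fun _ => Finset.univ)
            (fun j (k : Fin (L j).size) => ((L j).pt k.succ : ℝ) - (L j).pt k.castSucc)]
          simp_rw [Ladder.sum_length, Finset.prod_const_one, mul_one]
  calc _ = inner ℝ (∑ k, ε k • V k) f := by
        simp_rw [sum_inner, real_inner_smul_left, ← hε', hV, inner_boxDiffVec]
    _ ≤ ‖∑ k, ε k • V k‖ * ‖f‖ := real_inner_le_norm _ _
    _ ≤ √C * ‖f‖ := mul_le_mul_of_nonneg_right hnorm (norm_nonneg _)

end BoundedVariation

lemma isBVHK_unanchoredSpace {d : ℕ} (f : UnanchoredSpace d) :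
    IsBVHK (f : (Fin d → unitInterval) → ℝ) := by
  refine ENNReal.sum_lt_top.2 fun u _ => ?_
  set P : (u → unitInterval) → UnanchoredSpace d := fun z =>
    kerVec fun j => if h : j ∈ u then z ⟨j, h⟩ else 1 with hPdef
  have hf : faceRestrict f u = fun z => inner ℝ (P z) f := by
    funext z
    rw [hPdef, inner_kerVec]
    rfl
  have hP : ∀ z w, inner ℝ (P z) (P w)
      = (∏ _j ∈ uᶜ, (4 / 3 : ℝ)) * ∏ j, unanchoredKernel1 (z j) (w j) := by
    intro z w
    rw [hPdef, inner_kerVec_kerVec, unanchoredKernel, ← Finset.prod_compl_mul_prod u,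
      ← Finset.prod_coe_sort u]
    congr 1
    · refine Finset.prod_congr rfl fun j hj => ?_
      rw [Finset.mem_compl] at hj
      simp [hj, unanchoredKernel1]
    · refine Finset.prod_congr rfl fun j _ => ?_
      simp
  rw [hf]
  exact (vitaliVariation_inner_le hP f).trans_lt ENNReal.ofReal_lt_top

/-! ### Hat functions on dyadic intervals -/

/-- The point of `[0,1]` closest to `p / 2 ^ r`. -/
noncomputable def dyadicPt (r p : ℕ) : unitInterval :=
  Set.projIcc 0 1 zero_le_one ((p : ℝ) / 2 ^ r)

lemma coe_dyadicPt {r p : ℕ} (h : p ≤ 2 ^ r) : (dyadicPt r p : ℝ) = (p : ℝ) / 2 ^ r := by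
  have h' : (p : ℝ) ≤ 2 ^ r := by exact_mod_cast h
  rw [dyadicPt, Set.projIcc_of_mem]
  exact ⟨by positivity, (div_le_one (by positivity)).2 h'⟩

/-- The nodes of the functional which represents the hat function on `[q / 2 ^ r, (q + 1) / 2 ^ r]`:
integration, and evaluation at the endpoints and at the midpoint. -/
noncomputable def hatNode (r q : ℕ) : Fin 4 → Option unitInterval :=
  ![none, some (dyadicPt (r + 1) (2 * q)), some (dyadicPt (r + 1) (2 * q + 1)),
    some (dyadicPt (r + 1) (2 * q + 2))]

/-- The coefficients belonging to `hatNode`. The coefficient of the integral is chosen such that the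
function represented vanishes outside of the dyadic interval. -/
noncomputable def hatCoeff (r : ℕ) : Fin 4 → ℝ := ![((2 : ℝ) ^ (r + 1))⁻¹ ^ 2, -1, 2, -1]

/-- The hat function of height `2 ^ (-r - 1)` on the interval `[q / 2 ^ r, (q + 1) / 2 ^ r]`. -/
noncomputable def hat (r q : ℕ) (t : ℝ) : ℝ :=
  (|t - (2 * q : ℕ) / 2 ^ (r + 1)| - 2 * |t - (2 * q + 1 : ℕ) / 2 ^ (r + 1)|
    + |t - (2 * q + 2 : ℕ) / 2 ^ (r + 1)|) / 2

lemma hat_of_le {r q : ℕ} {t : ℝ} (h : t ≤ q / 2 ^ r) : hat r q t = 0 := by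
  have e : (q : ℝ) / 2 ^ r = 2 * q / 2 ^ (r + 1) := by rw [pow_succ]; field_simp
  rw [e] at h
  have h1 : (2 * q : ℝ) / 2 ^ (r + 1) ≤ (2 * q + 1) / 2 ^ (r + 1) := by gcongr; linarith
  have h2 : (2 * q : ℝ) / 2 ^ (r + 1) ≤ (2 * q + 2) / 2 ^ (r + 1) := by gcongr; linarith
  unfold hat
  push_cast
  rw [abs_of_nonpos (by linarith), abs_of_nonpos (by linarith), abs_of_nonpos (by linarith)]
  ring

lemma hat_of_ge {r q : ℕ} {t : ℝ} (h : ((q + 1 : ℕ) : ℝ) / 2 ^ r ≤ t) : hat r q t = 0 := by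
  have e : ((q + 1 : ℕ) : ℝ) / 2 ^ r = (2 * q + 2) / 2 ^ (r + 1) := by
    rw [pow_succ]; push_cast; field_simp
  rw [e] at h
  have h1 : (2 * q : ℝ) / 2 ^ (r + 1) ≤ (2 * q + 2) / 2 ^ (r + 1) := by gcongr; linarith
  have h2 : (2 * q + 1 : ℝ) / 2 ^ (r + 1) ≤ (2 * q + 2) / 2 ^ (r + 1) := by gcongr; linarith
  unfold hat
  push_cast
  rw [abs_of_nonneg (by linarith), abs_of_nonneg (by linarith), abs_of_nonneg (by linarith)]
  ring

lemma hat_dyadic (r q k : ℕ) : hat r q ((k : ℝ) / 2 ^ r) = 0 := by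
  rcases le_or_gt k q with h | h
  · exact hat_of_le (by gcongr)
  · exact hat_of_ge (by gcongr; exact h)

lemma hat_mid (r q q' : ℕ) : hat r q (((2 * q' + 1 : ℕ) : ℝ) / 2 ^ (r + 1))
    = if q = q' then ((2 : ℝ) ^ (r + 1))⁻¹ else 0 := by
  split_ifs with h
  · subst h
    have h0 : (0 : ℝ) < ((2 : ℝ) ^ (r + 1))⁻¹ := by positivity
    have h1 : ((2 * q + 1 : ℕ) : ℝ) / 2 ^ (r + 1) - (2 * q : ℕ) / 2 ^ (r + 1)
        = ((2 : ℝ) ^ (r + 1))⁻¹ := by push_cast; ring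
    have h2 : ((2 * q + 1 : ℕ) : ℝ) / 2 ^ (r + 1) - (2 * q + 2 : ℕ) / 2 ^ (r + 1)
        = -((2 : ℝ) ^ (r + 1))⁻¹ := by push_cast; ring
    rw [hat, h1, h2, sub_self, abs_zero, abs_neg, abs_of_pos h0]
    ring
  · rcases lt_or_gt_of_ne h with h | h
    · refine hat_of_ge ?_
      rw [pow_succ, div_le_div_iff₀ (by positivity) (by positivity)]
      have : ((q + 1 : ℕ) : ℝ) ≤ q' := by exact_mod_cast h
      push_cast at this ⊢
      nlinarith [pow_pos (two_pos (α := ℝ)) r]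
    · refine hat_of_le ?_
      rw [pow_succ, div_le_div_iff₀ (by positivity) (by positivity)]
      have : ((q' + 1 : ℕ) : ℝ) ≤ q := by exact_mod_cast h
      push_cast at this ⊢
      nlinarith [pow_pos (two_pos (α := ℝ)) r]

lemma sum_hatCoeff_mul_kerOpt_none (r q : ℕ) :
    ∑ a, hatCoeff r a * kerOpt none (hatNode r q a) = ((2 : ℝ) ^ (r + 1))⁻¹ ^ 2 := by
  simp [Fin.sum_univ_four, hatCoeff, kerOpt]
  ring

lemma sum_hatCoeff_mul_kerOpt_some {r q : ℕ} (hq : q < 2 ^ r) (t : unitInterval) :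
    ∑ a, hatCoeff r a * kerOpt (some t) (hatNode r q a) = hat r q t := by
  have h2 : 2 ^ (r + 1) = 2 * 2 ^ r := by ring
  simp only [Fin.sum_univ_four, hatCoeff, hatNode, kerOpt, unanchoredKernel1, hat,
    Matrix.cons_val_zero, Matrix.cons_val_one, Matrix.cons_val]
  rw [coe_dyadicPt (by omega), coe_dyadicPt (by omega), coe_dyadicPt (by omega)]
  push_cast
  field_simp
  ring

/-- The entries of the Gram matrix of the hat functions on the dyadic intervals
`[q / 2 ^ r, (q + 1) / 2 ^ r]` and `[q' / 2 ^ s, (q' + 1) / 2 ^ s]` in the one-dimensional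
unanchored space: the product of the integrals plus the `L²` product of the derivatives. -/
noncomputable def hatGram (r q s q' : ℕ) : ℝ :=
  ((2 : ℝ) ^ (r + 1))⁻¹ ^ 2 * ((2 : ℝ) ^ (s + 1))⁻¹ ^ 2
    + if r = s ∧ q = q' then ((2 : ℝ) ^ r)⁻¹ else 0

lemma hatGram_nonneg (r q s q' : ℕ) : 0 ≤ hatGram r q s q' := by
  unfold hatGram
  positivity

/-- The hat functions are orthogonal up to a rank-one term which comes from their integrals. -/
lemma sum_sum_hatCoeff_mul_kerOpt {r q s q' : ℕ} (hq : q < 2 ^ r) (hq' : q' < 2 ^ s) :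
    ∑ a, ∑ b, hatCoeff r a * hatCoeff s b * kerOpt (hatNode r q a) (hatNode s q' b)
      = hatGram r q s q' := by
  -- by symmetry, the first hat function may be assumed to be at least as fine as the second one
  have key : ∀ {r q s q' : ℕ}, q < 2 ^ r → q' < 2 ^ s → s ≤ r →
      ∑ a, ∑ b, hatCoeff r a * hatCoeff s b * kerOpt (hatNode r q a) (hatNode s q' b)
      = hatGram r q s q' := by
    clear hq hq' q q' r s
    intro r q s q' hq hq' hsr
    rw [hatGram]
    have h2 : 2 ^ (s + 1) = 2 * 2 ^ s := by ring
    rw [Finset.sum_comm]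
    have e1 : ∀ b, ∑ a, hatCoeff r a * hatCoeff s b * kerOpt (hatNode r q a) (hatNode s q' b)
        = hatCoeff s b * ∑ a, hatCoeff r a * kerOpt (hatNode s q' b) (hatNode r q a) := by
      intro b
      rw [Finset.mul_sum]
      refine Finset.sum_congr rfl fun a _ => ?_
      rw [kerOpt_comm]
      ring
    simp_rw [e1]
    rw [Fin.sum_univ_four]
    simp only [hatNode, Matrix.cons_val_zero, Matrix.cons_val_one, Matrix.cons_val]
    have n0 := sum_hatCoeff_mul_kerOpt_none r q
    have n1 := fun t => sum_hatCoeff_mul_kerOpt_some hq t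
    simp only [hatNode] at n0 n1
    rw [n0, n1, n1, n1, coe_dyadicPt (by omega), coe_dyadicPt (by omega), coe_dyadicPt (by omega)]
    simp only [hatCoeff, Matrix.cons_val_zero, Matrix.cons_val_one, Matrix.cons_val]
    rcases hsr.lt_or_eq with h | h
    · -- all nodes of the coarser hat function are multiples of `2 ^ (-r)`
      have e : ∀ k : ℕ, hat r q ((k : ℝ) / 2 ^ (s + 1)) = 0 := by
        intro k
        obtain ⟨m, rfl⟩ := Nat.exists_eq_add_of_lt h
        have : (k : ℝ) / 2 ^ (s + 1) = ((k * 2 ^ m : ℕ) : ℝ) / 2 ^ (s + m + 1) := by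
          rw [show s + m + 1 = s + 1 + m by ring, pow_add _ (s + 1)]
          push_cast
          field_simp
        rw [this, hat_dyadic]
      rw [e, e, e, if_neg (by omega)]
      ring
    · subst h
      have e0 : (((2 * q' : ℕ) : ℝ) / 2 ^ (s + 1)) = (q' : ℝ) / 2 ^ s := by
        rw [pow_succ]; push_cast; field_simp
      have e2 : (((2 * q' + 2 : ℕ) : ℝ) / 2 ^ (s + 1)) = ((q' + 1 : ℕ) : ℝ) / 2 ^ s := by
        rw [pow_succ]; push_cast; field_simp
      rw [e0, e2, hat_dyadic, hat_dyadic, hat_mid]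
      split_ifs with h1 h3 h3
      · rw [pow_succ]; field_simp; ring
      · exact absurd ⟨rfl, h1⟩ h3
      · exact absurd h3.2 h1
      · ring
  rcases le_total s r with h | h
  · exact key hq hq' h
  · have := key hq' hq h
    rw [Finset.sum_comm] at this
    convert this using 1
    · refine Finset.sum_congr rfl fun a _ => Finset.sum_congr rfl fun b _ => ?_
      rw [kerOpt_comm]
      ring
    · rw [hatGram, hatGram, mul_comm]
      congr 1
      by_cases h1 : r = s
      · subst h1; simp [eq_comm]
      · rw [if_neg (by tauto), if_neg (by tauto)]

/-- Sum of the Gram matrix of the one-dimensional hat functions over all those of a fixed level and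
all those of a level in a range: the bound does not depend on the range. -/
lemma sum_hat_gram_le (r m : ℕ) :
    ∑ q ∈ Finset.range (2 ^ r), ∑ s ∈ Finset.range m, ∑ q' ∈ Finset.range (2 ^ s),
      hatGram r q s q' ≤ 2 := by
  have h1 : ∀ q ∈ Finset.range (2 ^ r), ∑ s ∈ Finset.range m, ∑ q' ∈ Finset.range (2 ^ s),
      hatGram r q s q' ≤ 2 * ((2 : ℝ) ^ r)⁻¹ := by
    simp only [hatGram]
    intro q hq
    have a1 : ∀ s ∈ Finset.range m, ∑ q' ∈ Finset.range (2 ^ s),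
        (((2 : ℝ) ^ (r + 1))⁻¹ ^ 2 * ((2 : ℝ) ^ (s + 1))⁻¹ ^ 2
          + if r = s ∧ q = q' then ((2 : ℝ) ^ r)⁻¹ else 0)
        = ((2 : ℝ) ^ (r + 1))⁻¹ ^ 2 / 4 * (1 / 2) ^ s
          + if r = s then ((2 : ℝ) ^ r)⁻¹ else 0 := by
      intro s _
      rw [Finset.sum_add_distrib, Finset.sum_const, Finset.card_range, nsmul_eq_mul]
      congr 1
      · rw [pow_succ _ s, one_div, inv_pow 2 s]
        push_cast
        field_simp
        norm_num
      · by_cases h : r = s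
        · subst h
          simp only [true_and, if_true]
          rw [Finset.sum_ite_eq, if_pos hq]
        · simp [h]
    rw [Finset.sum_congr rfl a1, Finset.sum_add_distrib, ← Finset.mul_sum]
    have a2 : ∑ s ∈ Finset.range m, (1 / 2 : ℝ) ^ s ≤ 2 := sum_geometric_two_le m
    have a3 : ∑ s ∈ Finset.range m, (if r = s then ((2 : ℝ) ^ r)⁻¹ else 0) ≤ ((2 : ℝ) ^ r)⁻¹ := by
      rw [Finset.sum_ite_eq]
      split_ifs
      · exact le_rfl
      · positivity
    have a4 : ((2 : ℝ) ^ (r + 1))⁻¹ ^ 2 ≤ ((2 : ℝ) ^ r)⁻¹ := by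
      have b1 : ((2 : ℝ) ^ r)⁻¹ ≤ 1 := inv_le_one_of_one_le₀ (one_le_pow₀ one_le_two)
      have b2 : (0 : ℝ) < ((2 : ℝ) ^ r)⁻¹ := by positivity
      rw [pow_succ 2 r, mul_inv]
      nlinarith
    have a5 : (0 : ℝ) ≤ ((2 : ℝ) ^ (r + 1))⁻¹ ^ 2 := by positivity
    nlinarith
  calc _ ≤ ∑ q ∈ Finset.range (2 ^ r), 2 * ((2 : ℝ) ^ r)⁻¹ := Finset.sum_le_sum h1
    _ = 2 := by
      rw [Finset.sum_const, Finset.card_range, nsmul_eq_mul]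
      push_cast
      field_simp

/-! ### Tensor products of hat functions and the norm of the error functional -/

/-- The tensor product of the hat functions on `[q j / 2 ^ r j, (q j + 1) / 2 ^ r j]`, as an element
of the unanchored space; it is meant for `q j < 2 ^ r j`. -/
noncomputable def hatVec {d : ℕ} (r q : Fin d → ℕ) : UnanchoredSpace d :=
  ∑ σ : Fin d → Fin 4, (∏ j, hatCoeff (r j) (σ j)) • optVec fun j => hatNode (r j) (q j) (σ j)

lemma inner_optVec_hatVec {d : ℕ} (p : Fin d → Option unitInterval) (r q : Fin d → ℕ) :
    inner ℝ (optVec p) (hatVec r q)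
      = ∏ j, ∑ a, hatCoeff (r j) a * kerOpt (p j) (hatNode (r j) (q j) a) := by
  rw [Finset.prod_univ_sum, Fintype.piFinset_univ, hatVec, inner_sum]
  refine Finset.sum_congr rfl fun σ _ => ?_
  rw [real_inner_smul_right, inner_optVec_optVec, Finset.prod_mul_distrib]

lemma inner_hatVec_hatVec {d : ℕ} {r q s q' : Fin d → ℕ} (hq : ∀ j, q j < 2 ^ r j)
    (hq' : ∀ j, q' j < 2 ^ s j) :
    inner ℝ (hatVec r q) (hatVec s q') = ∏ j, hatGram (r j) (q j) (s j) (q' j) := by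
  have e : ∀ j, hatGram (r j) (q j) (s j) (q' j) = ∑ a, hatCoeff (r j) a *
      ∑ b, hatCoeff (s j) b * kerOpt (hatNode (r j) (q j) a) (hatNode (s j) (q' j) b) := by
    intro j
    rw [← sum_sum_hatCoeff_mul_kerOpt (hq j) (hq' j)]
    simp_rw [Finset.mul_sum, mul_assoc]
  simp_rw [e]
  rw [Finset.prod_univ_sum, Fintype.piFinset_univ]
  conv_lhs => rw [hatVec, sum_inner]
  refine Finset.sum_congr rfl fun σ _ => ?_
  rw [real_inner_smul_left, inner_optVec_hatVec, Finset.prod_mul_distrib]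

/-- The representer of the error functional of the quasi-Monte Carlo rule which uses the first `n`
points of `x`. -/
noncomputable def errVec {d : ℕ} (x : ℕ → Fin d → unitInterval) (n : ℕ) : UnanchoredSpace d :=
  optVec (fun _ => none) - (1 / (n : ℝ)) • ∑ i ∈ Finset.range n, kerVec (x i)

lemma inner_errVec {d : ℕ} (x : ℕ → Fin d → unitInterval) (n : ℕ) (f : UnanchoredSpace d) :
    inner ℝ (errVec x n) f = (∫ y, f y) - 1 / (n : ℝ) * ∑ i ∈ Finset.range n, f (x i) := by
  rw [errVec, inner_sub_left, inner_optVec_none, real_inner_smul_left, sum_inner]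
  simp_rw [inner_kerVec]

lemma inner_errVec_hatVec {d : ℕ} {x : ℕ → Fin d → unitInterval} {n : ℕ} {r q : Fin d → ℕ}
    (hq : ∀ j, q j < 2 ^ r j) (h : ∀ i < n, ∃ j, hat (r j) (q j) (x i j) = 0) :
    inner ℝ (errVec x n) (hatVec r q) = (4⁻¹ : ℝ) ^ (∑ j, r j + d) := by
  rw [errVec, inner_sub_left, real_inner_smul_left, sum_inner, Finset.sum_eq_zero, mul_zero,
    sub_zero, inner_optVec_hatVec]
  · simp_rw [sum_hatCoeff_mul_kerOpt_none]
    have e : ∀ j, ((2 : ℝ) ^ (r j + 1))⁻¹ ^ 2 = (4⁻¹ : ℝ) ^ (r j + 1) := by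
      intro j
      rw [inv_pow, ← pow_mul, mul_comm, pow_mul, inv_pow]
      norm_num
    simp_rw [e]
    rw [Finset.prod_pow_eq_pow_sum, Finset.sum_add_distrib]
    simp
  · intro i hi
    obtain ⟨j, hj⟩ := h i (Finset.mem_range.1 hi)
    rw [← optVec_some, inner_optVec_hatVec]
    refine Finset.prod_eq_zero (Finset.mem_univ j) ?_
    rw [sum_hatCoeff_mul_kerOpt_some (hq j), hj]

open Classical in
/-- The dyadic boxes of shape `r` whose hat function vanishes at the first `n` points of `x`. -/
noncomputable def emptyBoxes {d : ℕ} (x : ℕ → Fin d → unitInterval) (n : ℕ) (r : Fin d → ℕ) :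
    Finset (Fin d → ℕ) :=
  {q ∈ Fintype.piFinset fun j => Finset.range (2 ^ r j) |
    ∀ i < n, ∃ j, hat (r j) (q j) (x i j) = 0}

lemma eq_floor_of_hat_ne_zero {r q : ℕ} {t : ℝ} (h : hat r q t ≠ 0) : q = ⌊t * 2 ^ r⌋₊ := by
  have h1 : (q : ℝ) / 2 ^ r < t := by
    by_contra hc
    exact h (hat_of_le (not_lt.1 hc))
  have h2 : t < ((q + 1 : ℕ) : ℝ) / 2 ^ r := by
    by_contra hc
    exact h (hat_of_ge (not_lt.1 hc))
  rw [div_lt_iff₀ (by positivity)] at h1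
  rw [lt_div_iff₀ (by positivity)] at h2
  push_cast at h2
  exact ((Nat.floor_eq_iff ((Nat.cast_nonneg q).trans h1.le)).2 ⟨h1.le, h2⟩).symm

/-- Each point lies in the interior of at most one dyadic box of a given shape. -/
lemma two_pow_le_card_emptyBoxes_add {d : ℕ} (x : ℕ → Fin d → unitInterval) (n : ℕ)
    (r : Fin d → ℕ) : 2 ^ (∑ j, r j) ≤ (emptyBoxes x n r).card + n := by
  classical
  set A := Fintype.piFinset fun j => Finset.range (2 ^ r j) with hA
  have hcard : A.card = 2 ^ (∑ j, r j) := by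
    rw [hA, Fintype.card_piFinset]
    simp [Finset.prod_pow_eq_pow_sum]
  have hsub : A \ emptyBoxes x n r ⊆
      (Finset.range n).image fun i j => ⌊(x i j : ℝ) * 2 ^ r j⌋₊ := by
    intro q hq
    rw [Finset.mem_sdiff, emptyBoxes, Finset.mem_filter] at hq
    have h2 := not_and.1 hq.2 hq.1
    push Not at h2
    obtain ⟨i, hi, h⟩ := h2
    exact Finset.mem_image.2 ⟨i, Finset.mem_range.2 hi,
      funext fun j => (eq_floor_of_hat_ne_zero (h j)).symm⟩
  have h1 := (Finset.card_le_card hsub).trans Finset.card_image_le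
  rw [Finset.card_range] at h1
  have h2 : emptyBoxes x n r ⊆ A := Finset.filter_subset _ _
  rw [← hcard, ← Finset.card_sdiff_add_card_eq_card h2]
  omega

/-- The test function: the sum of the hat functions of all boxes with shape in `S` whose interior
contains none of the first `n` points of `x`. -/
noncomputable def testVec {d : ℕ} (x : ℕ → Fin d → unitInterval) (n : ℕ)
    (S : Finset (Fin d → ℕ)) : UnanchoredSpace d :=
  ∑ r ∈ S, ∑ q ∈ emptyBoxes x n r, hatVec r q

lemma lt_of_mem_emptyBoxes {d : ℕ} {x : ℕ → Fin d → unitInterval} {n : ℕ} {r q : Fin d → ℕ}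
    (h : q ∈ emptyBoxes x n r) (j : Fin d) : q j < 2 ^ r j :=
  Finset.mem_range.1 (Fintype.mem_piFinset.1 (Finset.mem_filter.1 h).1 j)

lemma le_inner_errVec_testVec {d : ℕ} (x : ℕ → Fin d → unitInterval) (n : ℕ) {m : ℕ}
    {S : Finset (Fin d → ℕ)} (hS : ∀ r ∈ S, ∑ j, r j = m) :
    S.card * (((2 : ℝ) ^ m - n) * (4⁻¹ : ℝ) ^ (m + d))
      ≤ inner ℝ (errVec x n) (testVec x n S) := by
  rw [testVec, inner_sum, ← nsmul_eq_mul]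
  refine Finset.card_nsmul_le_sum _ _ _ fun r hr => ?_
  rw [inner_sum, Finset.sum_congr rfl fun q hq => inner_errVec_hatVec (lt_of_mem_emptyBoxes hq)
    (Finset.mem_filter.1 hq).2, Finset.sum_const, nsmul_eq_mul, hS r hr]
  refine mul_le_mul_of_nonneg_right ?_ (by positivity)
  have := two_pow_le_card_emptyBoxes_add x n r
  rw [hS r hr] at this
  rw [sub_le_iff_le_add]
  exact_mod_cast this

/-- Although the hat functions are not orthogonal, their inner products are nonnegative and small
enough for the Gram matrix, summed over all boxes instead of the empty ones, to factorize into
one-dimensional sums which are bounded uniformly in the level. -/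
lemma norm_testVec_sq_le {d : ℕ} (x : ℕ → Fin d → unitInterval) (n : ℕ) {m : ℕ}
    {S : Finset (Fin d → ℕ)} (hS : ∀ r ∈ S, ∑ j, r j = m) :
    ‖testVec x n S‖ ^ 2 ≤ S.card * 2 ^ d := by
  classical
  have hB : ∀ r q s q' : Fin d → ℕ, 0 ≤ ∏ j, hatGram (r j) (q j) (s j) (q' j) :=
    fun r q s q' => Finset.prod_nonneg fun j _ => hatGram_nonneg _ _ _ _
  have hsub : ∀ r, emptyBoxes x n r ⊆ Fintype.piFinset fun j => Finset.range (2 ^ r j) :=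
    fun r => Finset.filter_subset _ _
  have hSsub : S ⊆ Fintype.piFinset fun _ => Finset.range (m + 1) := by
    intro s hs
    refine Fintype.mem_piFinset.2 fun j => Finset.mem_range_succ_iff.2 ?_
    rw [← hS s hs]
    exact Finset.single_le_sum (fun _ _ => Nat.zero_le _) (Finset.mem_univ j)
  rw [← real_inner_self_eq_norm_sq, testVec, sum_inner, ← nsmul_eq_mul]
  refine Finset.sum_le_card_nsmul _ _ _ fun r _ => ?_
  rw [sum_inner]
  calc _ = ∑ q ∈ emptyBoxes x n r, ∑ s ∈ S, ∑ q' ∈ emptyBoxes x n s,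
        ∏ j, hatGram (r j) (q j) (s j) (q' j) := by
        refine Finset.sum_congr rfl fun q hq => ?_
        simp_rw [inner_sum]
        refine Finset.sum_congr rfl fun s _ => Finset.sum_congr rfl fun q' hq' => ?_
        exact inner_hatVec_hatVec (lt_of_mem_emptyBoxes hq) (lt_of_mem_emptyBoxes hq')
    _ ≤ ∑ q ∈ Fintype.piFinset fun j => Finset.range (2 ^ r j),
        ∑ s ∈ Fintype.piFinset fun _ => Finset.range (m + 1),
        ∑ q' ∈ Fintype.piFinset fun j => Finset.range (2 ^ s j),
        ∏ j, hatGram (r j) (q j) (s j) (q' j) := by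
        refine (Finset.sum_le_sum fun q _ => ?_).trans (Finset.sum_le_sum_of_subset_of_nonneg
          (hsub r) fun q _ _ => Finset.sum_nonneg fun s _ => Finset.sum_nonneg fun q' _ => hB _ _ _ _)
        refine (Finset.sum_le_sum fun s _ => ?_).trans (Finset.sum_le_sum_of_subset_of_nonneg
          hSsub fun s _ _ => Finset.sum_nonneg fun q' _ => hB _ _ _ _)
        exact Finset.sum_le_sum_of_subset_of_nonneg (hsub s) fun q' _ _ => hB _ _ _ _
    _ = ∏ j, ∑ q ∈ Finset.range (2 ^ r j), ∑ s ∈ Finset.range (m + 1),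
        ∑ q' ∈ Finset.range (2 ^ s), hatGram (r j) q s q' := by
        simp_rw [Finset.prod_univ_sum]
    _ ≤ ∏ _j : Fin d, (2 : ℝ) := Finset.prod_le_prod
        (fun j _ => Finset.sum_nonneg fun q _ => Finset.sum_nonneg fun s _ =>
          Finset.sum_nonneg fun q' _ => hatGram_nonneg _ _ _ _)
        fun j _ => sum_hat_gram_le (r j) (m + 1)
    _ = 2 ^ d := by simp

lemma card_le_norm_errVec_sq {d : ℕ} (x : ℕ → Fin d → unitInterval) {n m : ℕ}
    (h1 : 2 * n ≤ 2 ^ m) (h2 : 2 ^ m ≤ 4 * n) {S : Finset (Fin d → ℕ)}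
    (hS : ∀ r ∈ S, ∑ j, r j = m) :
    (S.card : ℝ) ≤ (8 * 4 ^ d) ^ 2 * 2 ^ d * (n * ‖errVec x n‖) ^ 2 := by
  rcases S.eq_empty_or_nonempty with rfl | hne
  · simp only [Finset.card_empty, Nat.cast_zero]; positivity
  have hc : (0 : ℝ) < S.card := by exact_mod_cast hne.card_pos
  have h1' : 2 * (n : ℝ) ≤ 2 ^ m := by exact_mod_cast h1
  have h2' : (2 : ℝ) ^ m ≤ 4 * n := by exact_mod_cast h2
  have h3 := (le_inner_errVec_testVec x n hS).trans (real_inner_le_norm _ _)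
  have h4 := norm_testVec_sq_le x n hS
  have hp : (0 : ℝ) < 2 ^ m := by positivity
  have h5 : 1 ≤ 8 * 4 ^ d * n * (((2 : ℝ) ^ m - n) * (4⁻¹ : ℝ) ^ (m + d)) := by
    have e : (4⁻¹ : ℝ) ^ (m + d) = (2 ^ m * 2 ^ m * 4 ^ d)⁻¹ := by
      rw [inv_pow, pow_add, ← mul_pow]; norm_num
    rw [e, ← div_eq_mul_inv, ← mul_div_assoc, one_le_div (by positivity)]
    have : (2 : ℝ) ^ m * 2 ^ m ≤ 8 * n * (2 ^ m - n) := by nlinarith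
    calc (2 : ℝ) ^ m * 2 ^ m * 4 ^ d ≤ 8 * n * (2 ^ m - n) * 4 ^ d :=
          mul_le_mul_of_nonneg_right this (by positivity)
      _ = _ := by ring
  have h6 : (S.card : ℝ) ≤ 8 * 4 ^ d * n * (‖errVec x n‖ * ‖testVec x n S‖) := by
    calc (S.card : ℝ) ≤ S.card * (8 * 4 ^ d * n * (((2 : ℝ) ^ m - n) * (4⁻¹ : ℝ) ^ (m + d))) :=
          le_mul_of_one_le_right hc.le h5
      _ = 8 * 4 ^ d * n * (S.card * (((2 : ℝ) ^ m - n) * (4⁻¹ : ℝ) ^ (m + d))) := by ring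
      _ ≤ _ := mul_le_mul_of_nonneg_left h3 (by positivity)
  refine le_of_mul_le_mul_left ?_ hc
  calc (S.card : ℝ) * S.card = (S.card : ℝ) ^ 2 := by ring
    _ ≤ (8 * 4 ^ d * n * (‖errVec x n‖ * ‖testVec x n S‖)) ^ 2 := by gcongr
    _ = (8 * 4 ^ d * n * ‖errVec x n‖) ^ 2 * ‖testVec x n S‖ ^ 2 := by ring
    _ ≤ (8 * 4 ^ d * n * ‖errVec x n‖) ^ 2 * (S.card * 2 ^ d) := by gcongr
    _ = _ := by ring

/-- There are at least `(m / (d + 1)) ^ d` shapes of dyadic boxes of volume `2 ^ (-m)` in dimension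
`d + 1`. -/
lemma exists_shapes (d m : ℕ) : ∃ S : Finset (Fin (d + 1) → ℕ), (∀ r ∈ S, ∑ j, r j = m) ∧
    (m : ℝ) ^ d ≤ ((d : ℝ) + 1) ^ d * S.card := by
  classical
  set k := m / (d + 1) with hk
  -- the first exponent is determined by the others, which range freely over `0, ..., k`
  set A : Finset (Fin d → ℕ) := Fintype.piFinset fun _ => Finset.range (k + 1) with hA
  refine ⟨A.image fun g => Fin.cons (m - ∑ j, g j) g, ?_, ?_⟩
  · intro r hr
    obtain ⟨g, hg, rfl⟩ := Finset.mem_image.1 hr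
    have h1 : ∑ j, g j ≤ m := by
      calc ∑ j, g j ≤ ∑ _j : Fin d, k := Finset.sum_le_sum fun j _ =>
            Finset.mem_range_succ_iff.1 (Fintype.mem_piFinset.1 hg j)
        _ = d * k := by simp
        _ ≤ (d + 1) * k := Nat.mul_le_mul_right _ (Nat.le_succ d)
        _ ≤ m := Nat.mul_div_le m (d + 1)
    rw [Fin.sum_univ_succ]
    simp only [Fin.cons_zero, Fin.cons_succ]
    omega
  · rw [Finset.card_image_of_injective _ fun g g' h => (Fin.cons_inj.1 h).2, hA,
      Fintype.card_piFinset]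
    simp only [Finset.card_range, Finset.prod_const, Finset.card_univ, Fintype.card_fin]
    push_cast
    rw [← mul_pow]
    have h1 : m ≤ (d + 1) * (k + 1) := by
      have := Nat.lt_mul_div_succ m (Nat.succ_pos d)
      exact this.le
    have h2 : (m : ℝ) ≤ (d + 1) * (k + 1) := by exact_mod_cast h1
    gcongr

/-- Roth's lower bound for the worst-case error. -/
lemma exists_log_le_norm_errVec (d : ℕ) : ∃ C : ℝ, 0 < C ∧
    ∀ (x : ℕ → Fin (d + 1) → unitInterval) (n : ℕ), 1 ≤ n →
      Real.log n ^ d ≤ C * (n * ‖errVec x n‖) ^ 2 := by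
  refine ⟨((d : ℝ) + 1) ^ d * ((8 * 4 ^ (d + 1)) ^ 2 * 2 ^ (d + 1)), by positivity,
    fun x n hn => ?_⟩
  -- the volume of the boxes is chosen such that at least half of them are empty
  set m := Nat.log 2 n + 2 with hm
  have hlt : n < 2 ^ (Nat.log 2 n + 1) := Nat.lt_pow_succ_log_self one_lt_two n
  have hle : 2 ^ Nat.log 2 n ≤ n := Nat.pow_log_le_self 2 (by omega)
  have e1 : 2 ^ m = 2 * 2 ^ (Nat.log 2 n + 1) := by rw [hm]; ring
  have e2 : 2 ^ m = 4 * 2 ^ Nat.log 2 n := by rw [hm]; ring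
  obtain ⟨S, hS, hcard⟩ := exists_shapes d m
  have hmain := card_le_norm_errVec_sq x (n := n) (m := m) (by omega) (by omega) hS
  have hn' : (1 : ℝ) ≤ n := by exact_mod_cast hn
  have hlog : Real.log n ≤ m := by
    have h1 : Real.log n ≤ Real.log ((2 : ℝ) ^ m) :=
      Real.log_le_log (by linarith) (by exact_mod_cast (by omega : n ≤ 2 ^ m))
    rw [Real.log_pow] at h1
    have h2 : Real.log 2 ≤ 1 := by linarith [Real.log_two_lt_d9]
    exact h1.trans (mul_le_of_le_one_right (Nat.cast_nonneg m) h2)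
  calc Real.log n ^ d ≤ (m : ℝ) ^ d := pow_le_pow_left₀ (Real.log_nonneg hn') hlog d
    _ ≤ _ := hcard
    _ ≤ _ := by
      rw [mul_assoc]
      exact mul_le_mul_of_nonneg_left hmain (by positivity)

/-! ### Application of the uniform boundedness principle -/

/-- The uniform boundedness principle for a sequence of vectors: if the norms tend to infinity, then
some vector has unbounded inner products with the sequence. -/
lemma exists_frequently_lt_abs_inner {H : Type*} [NormedAddCommGroup H] [InnerProductSpace ℝ H]
    [CompleteSpace H] {u : ℕ → H} (hu : Tendsto (fun n => ‖u n‖) atTop atTop) :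
    ∃ f : H, ∀ C : ℝ, ∃ᶠ n in atTop, C < |inner ℝ (u n) f| := by
  by_contra hcon
  push Not at hcon
  have h : ∀ f : H, ∃ C, ∀ n, ‖innerSL ℝ (u n) f‖ ≤ C := by
    intro f
    obtain ⟨C, hC⟩ := hcon f
    have hb : IsBoundedUnder (· ≤ ·) atTop fun n => |inner ℝ (u n) f| := ⟨C, hC⟩
    obtain ⟨C', hC'⟩ := hb.bddAbove_range
    exact ⟨C', fun n => by simpa using hC' (Set.mem_range_self n)⟩
  obtain ⟨C, hC⟩ := banach_steinhaus h
  obtain ⟨n, hn⟩ := (hu.eventually_gt_atTop C).exists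
  have := hC n
  rw [innerSL_apply_norm] at this
  linarith

lemma abs_inner_errVec {d : ℕ} (x : ℕ → Fin d → unitInterval) (n : ℕ) (f : UnanchoredSpace d) :
    |inner ℝ (errVec x n) f| = qmcError x f n := by
  rw [inner_errVec, qmcError]

/-- The rate `(n log log n)⁻¹ (log n) ^ α` to which the error is compared. -/
noncomputable def errRate (α : ℝ) (n : ℕ) : ℝ :=
  ((n : ℝ) * Real.log (Real.log n))⁻¹ * Real.log n ^ α

lemma tendsto_log_log_nat :
    Tendsto (fun n : ℕ => Real.log (Real.log n)) atTop atTop :=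
  Real.tendsto_log_atTop.comp (Real.tendsto_log_atTop.comp tendsto_natCast_atTop_atTop)

lemma eventually_errRate_pos (α : ℝ) : ∀ᶠ n : ℕ in atTop, 0 < errRate α n := by
  filter_upwards [eventually_gt_atTop 0, tendsto_log_log_nat.eventually_gt_atTop 0,
    (Real.tendsto_log_atTop.comp tendsto_natCast_atTop_atTop).eventually_gt_atTop 0]
    with n hn hll hl
  have : (0 : ℝ) < n := by exact_mod_cast hn
  exact mul_pos (inv_pos.2 (mul_pos this hll)) (Real.rpow_pos_of_pos hl _)

lemma tendsto_norm_errVec_div_errRate {d : ℕ} (x : ℕ → Fin (d + 1) → unitInterval) :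
    Tendsto (fun n => ‖(errRate ((d : ℝ) / 2) n)⁻¹ • errVec x n‖) atTop atTop := by
  obtain ⟨C, hC, h⟩ := exists_log_le_norm_errVec d
  refine tendsto_atTop_mono' _ ?_ (tendsto_log_log_nat.const_mul_atTop
    (inv_pos.2 (Real.sqrt_pos.2 hC)))
  filter_upwards [eventually_ge_atTop 1, eventually_errRate_pos ((d : ℝ) / 2),
    tendsto_log_log_nat.eventually_gt_atTop 0,
    (Real.tendsto_log_atTop.comp tendsto_natCast_atTop_atTop).eventually_gt_atTop 0]
    with n hn hpos hll hl
  simp only [Function.comp_apply] at hl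
  have hn0 : (0 : ℝ) < n := by exact_mod_cast hn
  rw [norm_smul, Real.norm_of_nonneg (inv_nonneg.2 hpos.le), errRate]
  have hp : (0 : ℝ) < Real.log n ^ ((d : ℝ) / 2) := Real.rpow_pos_of_pos hl _
  have h1 : Real.log n ^ ((d : ℝ) / 2) ≤ √C * (n * ‖errVec x n‖) := by
    rw [← abs_of_pos hp, ← abs_of_nonneg (a := √C * (n * ‖errVec x n‖)) (by positivity),
      ← sq_le_sq, mul_pow, Real.sq_sqrt hC.le, ← Real.rpow_mul_natCast hl.le,
      show (d : ℝ) / 2 * (2 : ℕ) = d by push_cast; ring, Real.rpow_natCast]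
    exact h x n hn
  rw [inv_mul_eq_div, div_le_iff₀ (Real.sqrt_pos.2 hC), mul_inv, inv_inv]
  calc Real.log (Real.log n)
      = Real.log (Real.log n) * ((Real.log n ^ ((d : ℝ) / 2))⁻¹ * Real.log n ^ ((d : ℝ) / 2)) := by
        rw [inv_mul_cancel₀ hp.ne', mul_one]
    _ ≤ Real.log (Real.log n) * ((Real.log n ^ ((d : ℝ) / 2))⁻¹ *
        (√C * (n * ‖errVec x n‖))) := by gcongr
    _ = _ := by ring

/-- Every power of `log n` with an exponent smaller than `α` is eventually dominated by
`(log n) ^ α / log log n`. -/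
lemma eventually_le_errRate {r α : ℝ} (h : r < α) (c : ℝ) (hc : 0 < c) :
    ∀ᶠ n : ℕ in atTop, c * Real.log n ^ r / n ≤ errRate α n := by
  have ht : Tendsto (fun n : ℕ => Real.log n) atTop atTop :=
    Real.tendsto_log_atTop.comp tendsto_natCast_atTop_atTop
  have ho := ht.eventually ((isLittleO_log_rpow_atTop (sub_pos.2 h)).bound (inv_pos.2 hc))
  filter_upwards [ho, eventually_gt_atTop 0, tendsto_log_log_nat.eventually_gt_atTop 0,
    ht.eventually_gt_atTop 0] with n hn hn0 hll hl
  have hn0' : (0 : ℝ) < n := by exact_mod_cast hn0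
  rw [Real.norm_of_nonneg hll.le, Real.norm_of_nonneg (Real.rpow_nonneg hl.le _),
    inv_mul_eq_div, le_div_iff₀ hc] at hn
  have e : Real.log n ^ α = Real.log n ^ r * Real.log n ^ (α - r) := by
    rw [← Real.rpow_add hl]; congr 1; ring
  have hp : (0 : ℝ) < Real.log n ^ r := Real.rpow_pos_of_pos hl _
  rw [errRate, inv_mul_eq_div, div_le_div_iff₀ hn0' (by positivity), e]
  calc c * Real.log n ^ r * (n * Real.log (Real.log n))
      = Real.log n ^ r * (Real.log (Real.log n) * c) * n := by ring
    _ ≤ Real.log n ^ r * Real.log n ^ (α - r) * n := by gcongr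

theorem mainTheorem2 (d : ℕ) (hd : 1 ≤ d) (x : ℕ → Fin d → unitInterval) :
    ∃ f : UnanchoredSpace d,
      IsBVHK (f : (Fin d → unitInterval) → ℝ) ∧
      Integrable (f : (Fin d → unitInterval) → ℝ) volume ∧
      limsup (fun n : ℕ => ((qmcError x f n /
          (((n : ℝ) * Real.log (Real.log n))⁻¹ * Real.log n ^ (((d : ℝ) - 1) / 2)) : ℝ) : EReal))
        atTop = ⊤ ∧
      ∀ r : ℝ, r < ((d : ℝ) - 1) / 2 → ∀ c : ℝ, 0 < c →
        ∃ᶠ n : ℕ in atTop, c * Real.log n ^ r / n < qmcError x f n := by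
  obtain ⟨d, rfl⟩ := Nat.exists_eq_add_of_le' hd
  have hα : (((d + 1 : ℕ) : ℝ) - 1) / 2 = (d : ℝ) / 2 := by push_cast; ring
  rw [hα]
  obtain ⟨f, hf⟩ := exists_frequently_lt_abs_inner (tendsto_norm_errVec_div_errRate x)
  have hfreq : ∀ C : ℝ, ∃ᶠ n : ℕ in atTop,
      0 < errRate ((d : ℝ) / 2) n ∧ C < qmcError x f n / errRate ((d : ℝ) / 2) n := by
    intro C
    refine ((hf C).and_eventually (eventually_errRate_pos ((d : ℝ) / 2))).mono ?_
    rintro n ⟨hn, hpos⟩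
    rw [real_inner_smul_left, abs_mul, abs_of_pos (inv_pos.2 hpos), abs_inner_errVec,
      inv_mul_eq_div] at hn
    exact ⟨hpos, hn⟩
  refine ⟨f, isBVHK_unanchoredSpace f, integrable_unanchoredSpace f, ?_, fun r hr c hc => ?_⟩
  · refine (EReal.eq_top_iff_forall_lt _).2 fun C => ?_
    have h1 : ((C + 1 : ℝ) : EReal) ≤ limsup (fun n : ℕ => ((qmcError x f n /
          (((n : ℝ) * Real.log (Real.log n))⁻¹ * Real.log n ^ ((d : ℝ) / 2)) : ℝ) : EReal))
        atTop :=
      le_limsup_of_frequently_le ((hfreq (C + 1)).mono fun n hn => EReal.coe_le_coe_iff.2 hn.2.le)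
    exact (EReal.coe_lt_coe_iff.2 (lt_add_one C)).trans_le h1
  · refine ((hfreq 1).and_eventually (eventually_le_errRate hr c hc)).mono ?_
    rintro n ⟨⟨hpos, hn⟩, hle⟩
    exact hle.trans_lt ((one_lt_div hpos).1 hn)
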